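/- Let $S$ be a topological semigroup (a semigroup with a Tychonov topology for which the multiplication $S\times S\to S$ is jointly continuous). Suppose that $S$ is pseudocompact, i.e. each continuous real-valued function on $S$ is bounded, and that $S$ contains a totally bounded topological group $H$ as a dense subgroup: $H$ is a dense subsemigroup of $S$ which, with the operation and the topology inherited from $S$, is a topological group such that for every non-empty open $U\subset H$ there is a finite $F\subset H$ with $H=FU=UF$. For a class $\mathcal C$ of compact Hausdorff semigroups with separately continuous multiplication, the $\mathcal C$-compactification of $S$ is the (unique up to topological isomorphism) $\mathcal C(S)\in\mathcal C$ with a continuous homomorphism $\eta:S\to\mathcal C(S)$ such that each continuous homomorphism $h:S\to K\in\mathcal C$ factors as $h=\bar h\circ\eta$ for a unique continuous homomorphism $\bar h:\mathcal C(S)\to K$. Let $\mathrm{WAP}(S)$, $\mathrm{AP}(S)$, $\mathrm{SAP}(S)$ be the compactifications for the classes of all compact Hausdorff semigroups with separately continuous multiplication, of all compact Hausdorff semigroups with jointly continuous multiplication, and of all compact Hausdorff topological groups, respectively. Let $\beta S\to\mathrm{WAP}(S)$ be the continuous extension of $\eta:S\to\mathrm{WAP}(S)$ to the Stone-Čech compactification,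 and let $\mathrm{WAP}(S)\to\mathrm{AP}(S)$ and $\mathrm{AP}(S)\to\mathrm{SAP}(S)$ be the unique continuous homomorphisms that commute with the canonical homomorphisms from $S$. Then each of the three canonical maps $$\beta S\to\mathrm{WAP}(S)\to\mathrm{AP}(S)\to\mathrm{SAP}(S)$$ is a homeomorphism. Consequently $\beta S$ carries a group operation that extends the operation of $S$ and makes $\beta S$ a compact topological group. -/

import Mathlib

open Set Topology

open scoped Pointwise

universe u v w

section Basic

/-- A topological space is pseudocompact if every continuous real-valued function is bounded. -/
def IsPseudocompact (X : Type*) [TopologicalSpace X] : Prop :=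
  ∀ f : X → ℝ, Continuous f → ∃ C : ℝ, ∀ x, |f x| ≤ C

/-- A topological group `G` is totally bounded if for each non-empty open set `U` there is a
finite set `F` with `G = F U = U F`. -/
def IsTotallyBoundedGroup (G : Type*) [Group G] [TopologicalSpace G] : Prop :=
  ∀ U : Set G, IsOpen U → U.Nonempty →
    ∃ F : Set G, F.Finite ∧ F * U = Set.univ ∧ U * F = Set.univ

end Basic

section Resize

/-- A copy, in the universe `u`, of a `u`-small type. -/
def Resize (α : Type v) [Small.{u} α] : Type u := Shrink.{u} α

namespace Resize

variable (α : Type v) [Small.{u} α]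

noncomputable def equiv : Resize.{u} α ≃ α := (equivShrink α).symm

noncomputable instance [Mul α] : Mul (Resize.{u} α) := (equiv α).mul

noncomputable instance [Semigroup α] : Semigroup (Resize.{u} α) := (equiv α).semigroup

noncomputable instance [Group α] : Group (Resize.{u} α) := (equiv α).group

noncomputable instance [TopologicalSpace α] : TopologicalSpace (Resize.{u} α) :=
  TopologicalSpace.induced (equiv α) inferInstance

noncomputable def mulEquiv [Mul α] : Resize.{u} α ≃* α := (equiv α).mulEquiv

noncomputable def homeo [TopologicalSpace α] : Resize.{u} α ≃ₜ α :=
  (equiv α).toHomeomorphOfIsInducing ⟨rfl⟩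

theorem continuous_mulEquiv [Mul α] [TopologicalSpace α] : Continuous (mulEquiv.{u} α) :=
  (homeo α).continuous

theorem continuous_mulEquiv_symm [Mul α] [TopologicalSpace α] :
    Continuous (mulEquiv.{u} α).symm :=
  (homeo α).symm.continuous

instance [TopologicalSpace α] [CompactSpace α] : CompactSpace (Resize.{u} α) :=
  (homeo α).symm.compactSpace

instance [TopologicalSpace α] [T2Space α] : T2Space (Resize.{u} α) :=
  (homeo α).isEmbedding.t2Space

instance [Semigroup α] [TopologicalSpace α] [SeparatelyContinuousMul α] :
    SeparatelyContinuousMul (Resize.{u} α) :=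
  IsInducing.separatelyContinuousMul (mulEquiv.{u} α) ⟨rfl⟩

instance [Semigroup α] [TopologicalSpace α] [ContinuousMul α] :
    ContinuousMul (Resize.{u} α) :=
  IsInducing.continuousMul (mulEquiv.{u} α) ⟨rfl⟩

instance [Group α] [TopologicalSpace α] [IsTopologicalGroup α] :
    IsTopologicalGroup (Resize.{u} α) :=
  (⟨rfl⟩ : IsInducing (mulEquiv.{u} α)).topologicalGroup (mulEquiv.{u} α)

end Resize

theorem small_closure_range {α : Type u} {X : Type v} [TopologicalSpace X] [CompactSpace X]
    [T2Space X] (f : α → X) : Small.{u} (closure (range f)) := by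
  have h : closure (range f) ⊆ range (Ultrafilter.extend f) := by
    refine closure_minimal ?_ (isCompact_range (continuous_ultrafilter_extend f)).isClosed
    rintro _ ⟨a, rfl⟩
    exact ⟨pure a, ultrafilter_extend_pure f a⟩
  exact small_subset h

end Resize

section ClosedImage

/-- The closure of the image of a homomorphism into a compact semitopological semigroup. -/
def closedImage {S : Type u} [Semigroup S] {K : Type v} [Semigroup K] [TopologicalSpace K]
    [SeparatelyContinuousMul K] (h : S →ₙ* K) : Subsemigroup K :=
  h.srange.topologicalClosure

/-- The closed subgroup generated by the image of a semigroup homomorphism into a group. -/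
def closedGroupImage {S : Type u} [Semigroup S] {K : Type v} [Group K] [TopologicalSpace K]
    [IsTopologicalGroup K] (h : S →ₙ* K) : Subgroup K :=
  (Subgroup.closure (range h)).topologicalClosure

section

variable {S : Type u} [Semigroup S] {K : Type v} [Semigroup K] [TopologicalSpace K]
  [SeparatelyContinuousMul K] (h : S →ₙ* K)

theorem coe_closedImage : (closedImage h : Set K) = closure (range h) := by
  simp [closedImage, Subsemigroup.topologicalClosure]

instance [CompactSpace K] : CompactSpace (closedImage h) :=
  isCompact_iff_compactSpace.mp (by
    have : IsClosed (closedImage h : Set K) := by rw [coe_closedImage]; exact isClosed_closure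
    exact this.isCompact)

instance [CompactSpace K] [T2Space K] : Small.{u} (closedImage h) := by
  have := small_closure_range h
  rw [← coe_closedImage] at this
  exact this

/-- The homomorphism `h` with its codomain restricted to the closure of its image. -/
def toClosedImage : S →ₙ* closedImage h :=
  h.codRestrict _ fun s => by
    rw [← SetLike.mem_coe, coe_closedImage]; exact subset_closure ⟨s, rfl⟩

theorem denseRange_toClosedImage : DenseRange (toClosedImage h) := by
  have hr : range (Subtype.val ∘ toClosedImage h) = range h := rfl
  intro x
  rw [closure_subtype, ← range_comp, hr, ← coe_closedImage]
  exact x.2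

end

section

variable {S : Type u} [Semigroup S] {K : Type v} [Group K] [TopologicalSpace K]
  [IsTopologicalGroup K] (h : S →ₙ* K)

instance [CompactSpace K] : CompactSpace (closedGroupImage h) :=
  isCompact_iff_compactSpace.mp
    (Subgroup.isClosed_topologicalClosure (Subgroup.closure (range h))).isCompact

instance [CompactSpace K] [T2Space K] : Small.{u} (closedGroupImage h) := by
  have := small_closure_range (FreeGroup.lift (h : S → K))
  rw [← MonoidHom.coe_range, FreeGroup.range_lift_eq_closure] at this
  exact this

/-- The homomorphism `h` with its codomain restricted to the closed subgroup generated by its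
image. -/
def toClosedGroupImage : S →ₙ* closedGroupImage h :=
  h.codRestrict _ fun s =>
    Subgroup.le_topologicalClosure _ (Subgroup.subset_closure ⟨s, rfl⟩)

theorem closedGroupImage_hom_ext {L : Type w} [Group L] [TopologicalSpace L] [T2Space L]
    {f g : closedGroupImage h →ₙ* L} (hf : Continuous f) (hg : Continuous g)
    (hfg : ∀ s, f (toClosedGroupImage h s) = g (toClosedGroupImage h s)) : f = g := by
  let f' : closedGroupImage h →* L := MonoidHom.mk' f (map_mul f)
  let g' : closedGroupImage h →* L := MonoidHom.mk' g (map_mul g)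
  have hle : ∀ {x}, x ∈ Subgroup.closure (range h) → x ∈ closedGroupImage h :=
    fun hx => Subgroup.le_topologicalClosure _ hx
  have key : ∀ x (hx : x ∈ Subgroup.closure (range h)), f' ⟨x, hle hx⟩ = g' ⟨x, hle hx⟩ := by
    intro x hx
    induction hx using Subgroup.closure_induction with
    | mem x hx => obtain ⟨s, rfl⟩ := hx; exact hfg s
    | one => exact (map_one f').trans (map_one g').symm
    | mul x y hx hy ihx ihy =>
      have e : (⟨x * y, hle (mul_mem hx hy)⟩ : closedGroupImage h) =
          ⟨x, hle hx⟩ * ⟨y, hle hy⟩ := rfl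
      rw [e, map_mul f', map_mul g', ihx, ihy]
    | inv x hx ihx =>
      have e : (⟨x⁻¹, hle (inv_mem hx)⟩ : closedGroupImage h) = ⟨x, hle hx⟩⁻¹ := rfl
      rw [e, map_inv f', map_inv g', ihx]
  have hd : Dense {x : closedGroupImage h | (x : K) ∈ Subgroup.closure (range h)} := by
    intro x
    rw [closure_subtype]
    refine closure_mono ?_ x.2
    intro y hy
    exact ⟨⟨y, hle hy⟩, hy, rfl⟩
  refine DFunLike.coe_injective (Continuous.ext_on hd hf hg ?_)
  intro x hx
  exact key x hx

end

end ClosedImage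

section Targets

variable (S : Type u) [Semigroup S] [TopologicalSpace S]

/-- A continuous homomorphism from `S` to a compact Hausdorff semitopological semigroup. -/
structure WAPTarget : Type (u + 1) where
  K : Type u
  [semigroup : Semigroup K]
  [topology : TopologicalSpace K]
  [compact : CompactSpace K]
  [t2 : T2Space K]
  [continuousMul : SeparatelyContinuousMul K]
  hom : S →ₙ* K
  continuous_hom : Continuous hom

/-- A continuous homomorphism from `S` to a compact Hausdorff topological semigroup. -/
structure APTarget : Type (u + 1) where
  K : Type u
  [semigroup : Semigroup K]
  [topology : TopologicalSpace K]
  [compact : CompactSpace K]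
  [t2 : T2Space K]
  [continuousMul : ContinuousMul K]
  hom : S →ₙ* K
  continuous_hom : Continuous hom

/-- A continuous homomorphism from `S` to a compact Hausdorff topological group. -/
structure SAPTarget : Type (u + 1) where
  K : Type u
  [group : Group K]
  [topology : TopologicalSpace K]
  [compact : CompactSpace K]
  [t2 : T2Space K]
  [topologicalGroup : IsTopologicalGroup K]
  hom : S →ₙ* K
  continuous_hom : Continuous hom

attribute [instance] WAPTarget.semigroup WAPTarget.topology WAPTarget.compact WAPTarget.t2
  WAPTarget.continuousMul
attribute [instance] APTarget.semigroup APTarget.topology APTarget.compact APTarget.t2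
  APTarget.continuousMul
attribute [instance] SAPTarget.group SAPTarget.topology SAPTarget.compact SAPTarget.t2
  SAPTarget.topologicalGroup

/-- The diagonal homomorphism into the product of all targets. -/
def WAPTarget.diag : S →ₙ* (∀ t : WAPTarget S, t.K) where
  toFun s t := t.hom s
  map_mul' x y := funext fun t => map_mul t.hom x y

def APTarget.diag : S →ₙ* (∀ t : APTarget S, t.K) where
  toFun s t := t.hom s
  map_mul' x y := funext fun t => map_mul t.hom x y

def SAPTarget.diag : S →ₙ* (∀ t : SAPTarget S, t.K) where
  toFun s t := t.hom s
  map_mul' x y := funext fun t => map_mul t.hom x y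

end Targets

section WAPCompactification

variable (S : Type u) [Semigroup S] [TopologicalSpace S]

/-- The WAP-compactification of `S`: the closure of the diagonal image of `S` in the product of
all compact Hausdorff semitopological semigroups (in the universe of `S`) that receive a continuous
homomorphism from `S`. Its universal property, in all universes, is `WAP.existsUnique_lift`. -/
def WAP : Type u := Resize.{u} (closedImage (WAPTarget.diag S))

namespace WAP

noncomputable instance : Semigroup (WAP S) :=
  inferInstanceAs (Semigroup (Resize.{u} (closedImage (WAPTarget.diag S))))
noncomputable instance : TopologicalSpace (WAP S) :=
  inferInstanceAs (TopologicalSpace (Resize.{u} (closedImage (WAPTarget.diag S))))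
instance : CompactSpace (WAP S) :=
  inferInstanceAs (CompactSpace (Resize.{u} (closedImage (WAPTarget.diag S))))
instance : T2Space (WAP S) :=
  inferInstanceAs (T2Space (Resize.{u} (closedImage (WAPTarget.diag S))))
instance : SeparatelyContinuousMul (WAP S) :=
  inferInstanceAs (SeparatelyContinuousMul (Resize.{u} (closedImage (WAPTarget.diag S))))

noncomputable def incl : WAP S ≃* closedImage (WAPTarget.diag S) := Resize.mulEquiv _

theorem continuous_incl : Continuous (incl S) := Resize.continuous_mulEquiv _

/-- The canonic homomorphism `S → WAP(S)`. -/
noncomputable def eta : S →ₙ* WAP S :=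
  ((incl S).symm : closedImage (WAPTarget.diag S) →ₙ* WAP S).comp
    (toClosedImage (WAPTarget.diag S))

theorem continuous_eta : Continuous (eta S) :=
  (Resize.continuous_mulEquiv_symm _).comp
    (Continuous.subtype_mk (continuous_pi fun t : WAPTarget S => t.continuous_hom) _)

theorem denseRange_eta : DenseRange (eta S) :=
  (Resize.mulEquiv _).symm.surjective.denseRange.comp (denseRange_toClosedImage _)
    (Resize.continuous_mulEquiv_symm _)

/-- The universal property of the WAP-compactification. -/
theorem existsUnique_lift {K : Type v} [Semigroup K] [TopologicalSpace K] [CompactSpace K]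
    [T2Space K] [SeparatelyContinuousMul K] (h : S →ₙ* K) (hh : Continuous h) :
    ∃! g : WAP S →ₙ* K, Continuous g ∧ ∀ s, g (eta S s) = h s := by
  let e := Resize.mulEquiv.{u} (closedImage h)
  let t : WAPTarget S :=
    { K := Resize.{u} (closedImage h)
      hom := (e.symm : closedImage h →ₙ* Resize.{u} (closedImage h)).comp (toClosedImage h)
      continuous_hom := (Resize.continuous_mulEquiv_symm _).comp
        (Continuous.subtype_mk hh _) }
  let g : WAP S →ₙ* K :=
    { toFun := fun x => (e ((incl S x).1 t)).1
      map_mul' := fun x y => by simp [map_mul] }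
  refine ⟨g, ⟨?_, ?_⟩, ?_⟩
  · exact continuous_subtype_val.comp ((Resize.continuous_mulEquiv _).comp
      ((continuous_apply t).comp (continuous_subtype_val.comp (continuous_incl S))))
  · intro s
    change (e ((incl S ((incl S).symm (toClosedImage (WAPTarget.diag S) s))).1 t)).1 = h s
    rw [MulEquiv.apply_symm_apply]
    change (e (e.symm (toClosedImage h s))).1 = h s
    rw [MulEquiv.apply_symm_apply]
    rfl
  · rintro g' ⟨hg', hs⟩
    refine DFunLike.coe_injective ((denseRange_eta S).equalizer hg' ?_ ?_)
    · exact continuous_subtype_val.comp ((Resize.continuous_mulEquiv _).comp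
        ((continuous_apply t).comp (continuous_subtype_val.comp (continuous_incl S))))
    · funext s
      change g' (eta S s) =
        (e ((incl S ((incl S).symm (toClosedImage (WAPTarget.diag S) s))).1 t)).1
      rw [MulEquiv.apply_symm_apply, hs]
      change h s = (e (e.symm (toClosedImage h s))).1
      rw [MulEquiv.apply_symm_apply]
      rfl

end WAP

end WAPCompactification

section APCompactification

variable (S : Type u) [Semigroup S] [TopologicalSpace S]

/-- The AP-compactification of `S`: the closure of the diagonal image of `S` in the product of
all compact Hausdorff topological semigroups (in the universe of `S`) that receive a continuous
homomorphism from `S`. Its universal property, in all universes, is `AP.existsUnique_lift`. -/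
def AP : Type u := Resize.{u} (closedImage (APTarget.diag S))

namespace AP

noncomputable instance : Semigroup (AP S) :=
  inferInstanceAs (Semigroup (Resize.{u} (closedImage (APTarget.diag S))))
noncomputable instance : TopologicalSpace (AP S) :=
  inferInstanceAs (TopologicalSpace (Resize.{u} (closedImage (APTarget.diag S))))
instance : CompactSpace (AP S) :=
  inferInstanceAs (CompactSpace (Resize.{u} (closedImage (APTarget.diag S))))
instance : T2Space (AP S) :=
  inferInstanceAs (T2Space (Resize.{u} (closedImage (APTarget.diag S))))
instance : ContinuousMul (AP S) :=
  inferInstanceAs (ContinuousMul (Resize.{u} (closedImage (APTarget.diag S))))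

noncomputable def incl : AP S ≃* closedImage (APTarget.diag S) := Resize.mulEquiv _

theorem continuous_incl : Continuous (incl S) := Resize.continuous_mulEquiv _

/-- The canonic homomorphism `S → AP(S)`. -/
noncomputable def eta : S →ₙ* AP S :=
  ((incl S).symm : closedImage (APTarget.diag S) →ₙ* AP S).comp
    (toClosedImage (APTarget.diag S))

theorem continuous_eta : Continuous (eta S) :=
  (Resize.continuous_mulEquiv_symm _).comp
    (Continuous.subtype_mk (continuous_pi fun t : APTarget S => t.continuous_hom) _)

theorem denseRange_eta : DenseRange (eta S) :=
  (Resize.mulEquiv _).symm.surjective.denseRange.comp (denseRange_toClosedImage _)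
    (Resize.continuous_mulEquiv_symm _)

/-- The universal property of the AP-compactification. -/
theorem existsUnique_lift {K : Type v} [Semigroup K] [TopologicalSpace K] [CompactSpace K]
    [T2Space K] [ContinuousMul K] (h : S →ₙ* K) (hh : Continuous h) :
    ∃! g : AP S →ₙ* K, Continuous g ∧ ∀ s, g (eta S s) = h s := by
  let e := Resize.mulEquiv.{u} (closedImage h)
  let t : APTarget S :=
    { K := Resize.{u} (closedImage h)
      hom := (e.symm : closedImage h →ₙ* Resize.{u} (closedImage h)).comp (toClosedImage h)
      continuous_hom := (Resize.continuous_mulEquiv_symm _).comp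
        (Continuous.subtype_mk hh _) }
  let g : AP S →ₙ* K :=
    { toFun := fun x => (e ((incl S x).1 t)).1
      map_mul' := fun x y => by simp [map_mul] }
  have hg : Continuous g := continuous_subtype_val.comp ((Resize.continuous_mulEquiv _).comp
      ((continuous_apply t).comp (continuous_subtype_val.comp (continuous_incl S))))
  have hgs : ∀ s, g (eta S s) = h s := by
    intro s
    change (e ((incl S ((incl S).symm (toClosedImage (APTarget.diag S) s))).1 t)).1 = h s
    rw [MulEquiv.apply_symm_apply]
    change (e (e.symm (toClosedImage h s))).1 = h s
    rw [MulEquiv.apply_symm_apply]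
    rfl
  refine ⟨g, ⟨hg, hgs⟩, ?_⟩
  rintro g' ⟨hg', hs⟩
  exact DFunLike.coe_injective ((denseRange_eta S).equalizer hg' hg
    (funext fun s => (hs s).trans (hgs s).symm))

end AP

end APCompactification

section SAPCompactification

variable (S : Type u) [Semigroup S] [TopologicalSpace S]

/-- The SAP-compactification of `S`: the closed subgroup generated by the diagonal image of `S` in
the product of all compact Hausdorff topological groups (in the universe of `S`) that receive a
continuous homomorphism from `S`. Its universal property, in all universes, is
`SAP.existsUnique_lift`. -/
def SAP : Type u := Resize.{u} (closedGroupImage (SAPTarget.diag S))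

namespace SAP

noncomputable instance : Group (SAP S) :=
  inferInstanceAs (Group (Resize.{u} (closedGroupImage (SAPTarget.diag S))))
noncomputable instance : TopologicalSpace (SAP S) :=
  inferInstanceAs (TopologicalSpace (Resize.{u} (closedGroupImage (SAPTarget.diag S))))
instance : CompactSpace (SAP S) :=
  inferInstanceAs (CompactSpace (Resize.{u} (closedGroupImage (SAPTarget.diag S))))
instance : T2Space (SAP S) :=
  inferInstanceAs (T2Space (Resize.{u} (closedGroupImage (SAPTarget.diag S))))
instance : IsTopologicalGroup (SAP S) :=
  inferInstanceAs (IsTopologicalGroup (Resize.{u} (closedGroupImage (SAPTarget.diag S))))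

noncomputable def incl : SAP S ≃* closedGroupImage (SAPTarget.diag S) := Resize.mulEquiv _

theorem continuous_incl : Continuous (incl S) := Resize.continuous_mulEquiv _

/-- The canonic homomorphism `S → SAP(S)`. -/
noncomputable def eta : S →ₙ* SAP S :=
  ((incl S).symm : closedGroupImage (SAPTarget.diag S) →ₙ* SAP S).comp
    (toClosedGroupImage (SAPTarget.diag S))

theorem continuous_eta : Continuous (eta S) :=
  (Resize.continuous_mulEquiv_symm _).comp
    (Continuous.subtype_mk (continuous_pi fun t : SAPTarget S => t.continuous_hom) _)

theorem hom_ext {L : Type w} [Group L] [TopologicalSpace L] [T2Space L]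
    {f g : SAP S →ₙ* L} (hf : Continuous f) (hg : Continuous g)
    (hfg : ∀ s, f (eta S s) = g (eta S s)) : f = g := by
  have hc : Continuous (incl S).symm := Resize.continuous_mulEquiv_symm _
  have := closedGroupImage_hom_ext (SAPTarget.diag S)
    (f := f.comp ((incl S).symm : closedGroupImage (SAPTarget.diag S) →ₙ* SAP S))
    (g := g.comp ((incl S).symm : closedGroupImage (SAPTarget.diag S) →ₙ* SAP S))
    (hf.comp hc) (hg.comp hc) hfg
  ext x
  have hx := DFunLike.congr_fun this (incl S x)
  simpa using hx

/-- The universal property of the SAP-compactification. -/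
theorem existsUnique_lift {K : Type v} [Group K] [TopologicalSpace K] [CompactSpace K]
    [T2Space K] [IsTopologicalGroup K] (h : S →ₙ* K) (hh : Continuous h) :
    ∃! g : SAP S →ₙ* K, Continuous g ∧ ∀ s, g (eta S s) = h s := by
  let e := Resize.mulEquiv.{u} (closedGroupImage h)
  let t : SAPTarget S :=
    { K := Resize.{u} (closedGroupImage h)
      hom := (e.symm : closedGroupImage h →ₙ* Resize.{u} (closedGroupImage h)).comp
        (toClosedGroupImage h)
      continuous_hom := (Resize.continuous_mulEquiv_symm _).comp
        (Continuous.subtype_mk hh _) }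
  let g : SAP S →ₙ* K :=
    { toFun := fun x => (e ((incl S x).1 t)).1
      map_mul' := fun x y => by
        rw [map_mul]
        change (e ((incl S x).1 t * (incl S y).1 t)).1 = _
        rw [map_mul]
        rfl }
  have hg : Continuous g := continuous_subtype_val.comp ((Resize.continuous_mulEquiv _).comp
      ((continuous_apply t).comp (continuous_subtype_val.comp (continuous_incl S))))
  have hgs : ∀ s, g (eta S s) = h s := by
    intro s
    change (e ((incl S ((incl S).symm (toClosedGroupImage (SAPTarget.diag S) s))).1 t)).1 = h s
    rw [MulEquiv.apply_symm_apply]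
    change (e (e.symm (toClosedGroupImage h s))).1 = h s
    rw [MulEquiv.apply_symm_apply]
    rfl
  refine ⟨g, ⟨hg, hgs⟩, ?_⟩
  rintro g' ⟨hg', hs⟩
  exact hom_ext S hg' hg fun s => (hs s).trans (hgs s).symm

end SAP

end SAPCompactification

section CanonicalMaps

variable (S : Type u) [Semigroup S] [TopologicalSpace S]

/-- The extension `βS → WAP(S)` of the canonic homomorphism `S → WAP(S)`. -/
noncomputable def stoneCechToWAP : StoneCech S → WAP S :=
  stoneCechExtend (WAP.continuous_eta S)

/-- The canonical homomorphism `WAP(S) → AP(S)`: the unique continuous homomorphism over `S`. -/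
noncomputable def wapToAP : WAP S →ₙ* AP S :=
  (WAP.existsUnique_lift S (AP.eta S) (AP.continuous_eta S)).choose

/-- The canonical homomorphism `AP(S) → SAP(S)`: the unique continuous homomorphism over `S`. -/
noncomputable def apToSAP : AP S →ₙ* SAP S :=
  (AP.existsUnique_lift S (SAP.eta S) (SAP.continuous_eta S)).choose

theorem wapToAP_spec : Continuous (wapToAP S) ∧ ∀ s, wapToAP S (WAP.eta S s) = AP.eta S s :=
  (WAP.existsUnique_lift S (AP.eta S) (AP.continuous_eta S)).choose_spec.1

theorem apToSAP_spec : Continuous (apToSAP S) ∧ ∀ s, apToSAP S (AP.eta S s) = SAP.eta S s :=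
  (AP.existsUnique_lift S (SAP.eta S) (SAP.continuous_eta S)).choose_spec.1

end CanonicalMaps

/-! ### Totally bounded groups and their compact completions. -/

namespace IsTotallyBoundedGroup

open Filter

variable {H : Type*} [Group H] [TopologicalSpace H]

/-! The completion `K` of the totally bounded group `H` is a compact group, and everything reduces
to showing that `K` is `βS`. The dense subgroup controls `S`: finitely many translates of a small
closed set cover `S`, so `H → K` extends to a continuous homomorphism `φ : S → K`
(`exists_continuous_hom_extension`), and translating by elements of `H` shows that `φ` is inducing
(`isInducing_of_extension`). Thus `S` sits in `K` as a dense pseudocompact subspace.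

That such a subspace has `K` as its Stone-Čech compactification comes from Haar measure. For open
`W` in `K`, the function `z ↦ μ(z⁻¹W ∆ W)` is continuous, and its zeros translate `closure W` into
itself. Pseudocompactness makes every nonempty zero set in `K` meet `φ(S)`. So a point common to the
closures of two open sets can be moved into `φ(S)` without leaving either closure; hence sets
separated by a continuous function on `S` have disjoint closures in `K`
(`IsPseudocompact.disjoint_closure_image`).

Finally, `K` belongs to all three classes, so the homeomorphism `βS → K` factors through the three
compactifications, which forces every canonical map to be bijective (`isHomeomorph_canonical_maps`).
-/

theorem exists_finite_mul_eq_univ (hH : IsTotallyBoundedGroup H) {V : Set H}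
    (hV : V ∈ 𝓝 (1 : H)) : ∃ F : Set H, F.Finite ∧ F * V = univ ∧ V * F = univ := by
  obtain ⟨F, hF, h₁, h₂⟩ := hH (interior V) isOpen_interior ⟨1, mem_interior_iff_mem_nhds.2 hV⟩
  exact ⟨F, hF, univ_subset_iff.1 (h₁ ▸ mul_subset_mul_left interior_subset),
    univ_subset_iff.1 (h₂ ▸ mul_subset_mul_right interior_subset)⟩

variable [IsTopologicalGroup H]

/-- A totally bounded group has arbitrarily small conjugation-invariant neighbourhoods of `1`. -/
theorem exists_conj_mem (hH : IsTotallyBoundedGroup H) {U : Set H} (hU : U ∈ 𝓝 (1 : H)) :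
    ∃ V ∈ 𝓝 (1 : H), ∀ v ∈ V, ∀ x, x * v * x⁻¹ ∈ U := by
  have h3 : ContinuousAt (fun p : H × H => p.1 * p.2 * p.1⁻¹) (1, 1) := by fun_prop
  have h3U := h3 (show U ∈ 𝓝 ((1 : H) * 1 * 1⁻¹) by simpa using hU)
  rw [mem_map, nhds_prod_eq, mem_prod_self_iff] at h3U
  obtain ⟨V, hV, hVU⟩ := h3U
  obtain ⟨F, hF, -, hVF⟩ := hH.exists_finite_mul_eq_univ hV
  -- Every `x` is `a * f` with `a ∈ V` and `f ∈ F`. Conjugation by `f` is one of finitely many maps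
  -- and lands in `V`; conjugation by the small element `a` then lands in `U`.
  refine ⟨⋂ f ∈ F, (fun v => f * v * f⁻¹) ⁻¹' V, (biInter_mem hF).2 fun f _ => ?_, ?_⟩
  · have hc : ContinuousAt (fun v : H => f * v * f⁻¹) 1 := by fun_prop
    exact hc (by simpa using hV)
  · intro v hv x
    obtain ⟨a, ha, f, hf, rfl⟩ := hVF.ge (mem_univ x)
    have := @hVU (a, f * v * f⁻¹) ⟨ha, mem_iInter₂.1 hv f hf⟩
    simpa [mul_assoc] using this

/-- Conjugation by the first coordinate exchanges `p.2 * p.1⁻¹` and `p.1⁻¹ * p.2`, so uniformly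
small conjugates make the left and right uniformities equal. -/
theorem isUniformGroup (hH : IsTotallyBoundedGroup H) :
    @IsUniformGroup H (IsTopologicalGroup.rightUniformSpace H) _ := by
  let := IsTopologicalGroup.rightUniformSpace H
  have hl : uniformity H = comap (fun p : H × H => p.1⁻¹ * p.2) (𝓝 1) := by
    rw [uniformity_eq_comap_nhds_one']
    refine le_antisymm ?_ ?_ <;> rw [← tendsto_iff_comap] <;> intro U hU <;>
      obtain ⟨V, hV, hVU⟩ := hH.exists_conj_mem hU
    · refine ⟨V, hV, fun p hp => ?_⟩
      simpa [mul_assoc] using hVU _ hp p.1⁻¹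
    · refine ⟨V, hV, fun p hp => ?_⟩
      simpa [mul_assoc] using hVU _ hp p.1
  have : IsLeftUniformGroup H := ⟨hl⟩
  have : IsRightUniformGroup H := ⟨rfl⟩
  exact IsUniformGroup.of_left_right

/-- A totally bounded group admits a dense inducing homomorphism into a compact group. -/
theorem exists_compact_completion {H : Type v} [Group H] [TopologicalSpace H]
    [IsTopologicalGroup H] (hH : IsTotallyBoundedGroup H) :
    ∃ (K : Type v) (_ : Group K) (_ : TopologicalSpace K) (_ : IsTopologicalGroup K)
      (_ : CompactSpace K) (_ : T2Space K) (j : H →* K), IsDenseInducing j := by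
  let := IsTopologicalGroup.rightUniformSpace H
  have := hH.isUniformGroup
  -- The completion is taken of the additive copy of `H`, and `Multiplicative` restores the notation
  -- at the end; commutativity is not involved.
  have : IsUniformAddGroup (Additive H) := ⟨uniformContinuous_div (α := H)⟩
  let C := UniformSpace.Completion (Additive H)
  have htb : TotallyBounded (univ : Set (Additive H)) := by
    rw [totallyBounded_iff_subset_finite_iUnion_nhds_zero]
    intro U hU
    obtain ⟨F, hF, hFU, -⟩ := hH.exists_finite_mul_eq_univ (V := Additive.ofMul ⁻¹' U) hU
    refine ⟨Additive.toMul ⁻¹' F, hF.preimage (Additive.toMul.injective.injOn), fun x _ => ?_⟩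
    obtain ⟨f, hf, y, hy, hfy⟩ := hFU.ge (mem_univ x.toMul)
    exact mem_iUnion₂.2 ⟨Additive.ofMul f, hf, Additive.ofMul y, hy, hfy⟩
  have : CompactSpace C := by
    refine ⟨TotallyBounded.isCompact_of_isClosed ?_ isClosed_univ⟩
    have := (htb.image (UniformSpace.Completion.uniformContinuous_coe (Additive H))).closure
    rwa [image_univ, UniformSpace.Completion.denseRange_coe.closure_range] at this
  let j : H →* Multiplicative C :=
    AddMonoidHom.toMultiplicativeRight (UniformSpace.Completion.toCompl (α := Additive H))
  exact ⟨Multiplicative C, inferInstance, inferInstance, inferInstance, inferInstance,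
    inferInstanceAs (T2Space C), j, UniformSpace.Completion.isDenseInducing_toCompl (Additive H)⟩

end IsTotallyBoundedGroup

/-! ### Haar measure and translations of open sets. -/

section HaarTranslation

open MeasureTheory Filter
open scoped symmDiff

/-- In a compact group the left translations that preserve the closure of a given open set contain
the zero set of a continuous function vanishing at `1`. -/
theorem exists_continuous_smul_closure_subset {K : Type*} [Group K] [TopologicalSpace K]
    [IsTopologicalGroup K] [CompactSpace K] {W : Set K} (hW : IsOpen W) :
    ∃ u : K → ℝ, Continuous u ∧ (∀ z, 0 ≤ u z) ∧ u 1 = 0 ∧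
      ∀ z, u z = 0 → ∀ x ∈ closure W, z * x ∈ closure W := by
  let : MeasurableSpace K := borel K
  have : BorelSpace K := ⟨rfl⟩
  let μ : Measure K := Measure.haar
  let T : K → C(K, K) := fun z => ⟨fun x => z * x, by fun_prop⟩
  have hT : Continuous T := ContinuousMap.continuous_of_continuous_uncurry _ (by
    simpa [Function.uncurry_def, T] using (continuous_mul (M := K)))
  have hTm : ∀ z, MeasurePreserving (T z) μ μ := fun z => measurePreserving_mul_left μ z
  let D : K → Set K := fun z => (T z ⁻¹' W) ∆ W
  -- Triangle inequality for the pseudometric `μ(A ∆ B)`; it reduces continuity of `z ↦ μ(D z)` to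
  -- that of `z ↦ T z ⁻¹' W`.
  have htri : ∀ a b, μ.real (D a) ≤ μ.real (D b) + μ.real ((T a ⁻¹' W) ∆ (T b ⁻¹' W)) := by
    intro a b
    refine (measureReal_mono ?_).trans ((measureReal_union_le _ _).trans (add_comm _ _).le)
    exact symmDiff_triangle _ _ _
  refine ⟨fun z => μ.real (D z), ?_, fun z => measureReal_nonneg, ?_, ?_⟩
  · rw [continuous_iff_continuousAt]
    intro z
    have h0 : Tendsto (fun a => μ.real ((T a ⁻¹' W) ∆ (T z ⁻¹' W))) (𝓝 z) (𝓝 0) := by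
      have := tendsto_measure_symmDiff_preimage_nhds_zero (hT.tendsto z) (.of_forall hTm) (hTm z)
        hW.measurableSet.nullMeasurableSet (measure_ne_top μ W)
      simpa [Measure.real, Function.comp_def] using (ENNReal.tendsto_toReal ENNReal.zero_ne_top).comp this
    rw [ContinuousAt, tendsto_iff_dist_tendsto_zero]
    refine squeeze_zero (fun _ => dist_nonneg) (fun a => ?_) h0
    rw [Real.dist_eq, abs_sub_le_iff]
    constructor
    · linarith [htri a z]
    · have := htri z a
      rw [symmDiff_comm] at this
      linarith
  · have : D 1 = ∅ := by simp [D, T]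
    simp [this]
  · intro z hz
    have hz0 : μ (D z) = 0 := (measureReal_eq_zero_iff).1 hz
    -- The points of `W` sent outside `closure W` form an open subset of the null set `D z`, and
    -- Haar measure is positive on nonempty open sets.
    have hsub : W ⊆ T z ⁻¹' closure W := by
      by_contra hne
      obtain ⟨x, hxW, hx⟩ := not_subset.1 hne
      have ho : IsOpen (W ∩ T z ⁻¹' (closure W)ᶜ) :=
        hW.inter (isClosed_closure.isOpen_compl.preimage (T z).continuous)
      refine (ho.measure_pos μ ⟨x, hxW, hx⟩).ne' (measure_mono_null ?_ hz0)
      rintro y ⟨hyW, hy⟩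
      exact Or.inr ⟨hyW, fun h => hy (subset_closure h)⟩
    exact fun x hx => closure_minimal hsub (isClosed_closure.preimage (T z).continuous) hx

end HaarTranslation

/-! ### Extending the completion map from the dense subgroup to the semigroup. -/

section CompactExtension

open Filter

variable {S : Type*} [Semigroup S] [TopologicalSpace S] [ContinuousMul S] {H : Type*} [Group H]
  {i : H →ₙ* S}

/-- `S` is not assumed to have an identity; density of the group supplies the right identity that
the neighbourhood argument at `(p, i 1)` needs. -/
theorem map_mul_one_of_denseRange [T2Space S] (hi : DenseRange i) (s : S) : s * i 1 = s := by
  refine congr_fun (hi.equalizer (g := fun s => s * i 1) (h := id) (by fun_prop) continuous_id ?_) s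
  funext h
  simp [← map_mul]

variable [T3Space S] [TopologicalSpace H]

/-- Points of `S` have neighbourhoods whose traces on a dense totally bounded subgroup are small
for the left uniformity. -/
theorem exists_mem_nhds_inv_mul_mem [IsTopologicalGroup H] (hH : IsTotallyBoundedGroup H)
    (hi : IsDenseInducing i) {U : Set H} (hU : U ∈ 𝓝 (1 : H)) (s : S) :
    ∃ P ∈ 𝓝 s, ∀ x y, i x ∈ P → i y ∈ P → x⁻¹ * y ∈ U := by
  have hc : ContinuousAt (fun p : H × H => p.1⁻¹ * p.2) (1, 1) := by fun_prop
  have hcU := hc (show U ∈ 𝓝 ((1 : H)⁻¹ * 1) by simpa using hU)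
  rw [mem_map, nhds_prod_eq, mem_prod_self_iff] at hcU
  obtain ⟨V, hV, hVU⟩ := hcU
  rw [hi.nhds_eq_comap, mem_comap] at hV
  obtain ⟨O', hO', hO'V⟩ := hV
  obtain ⟨O, hO, hOcl, hOO'⟩ := exists_mem_nhds_isClosed_subset (interior_mem_nhds.2 hO')
  obtain ⟨F, hF, hFO, -⟩ := hH.exists_finite_mul_eq_univ (hi.continuous.continuousAt hO)
  -- A finite union of closed sets containing the dense image of `H` is all of `S`; this is why `O`
  -- was chosen closed. The translating factor `f` later cancels in `x⁻¹ * y`.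
  have hcov : univ ⊆ ⋃ f ∈ F, (fun t => i f⁻¹ * t) ⁻¹' O := by
    rw [← hi.dense.closure_range]
    refine closure_minimal ?_ (hF.isClosed_biUnion fun f _ => hOcl.preimage (by fun_prop))
    rintro _ ⟨h, rfl⟩
    obtain ⟨f, hf, y, hy, rfl⟩ := hFO.ge (mem_univ h)
    refine mem_iUnion₂.2 ⟨f, hf, ?_⟩
    simpa [← map_mul] using hy
  obtain ⟨f, -, hfs⟩ := mem_iUnion₂.1 (hcov (mem_univ s))
  have hfc : Continuous fun t : S => i f⁻¹ * t := by fun_prop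
  refine ⟨_, hfc.continuousAt (mem_interior_iff_mem_nhds.1 (hOO' hfs)), fun x y hx hy => ?_⟩
  have hx' : f⁻¹ * x ∈ V := hO'V (by simpa using hx)
  have hy' : f⁻¹ * y ∈ V := hO'V (by simpa using hy)
  simpa [mul_assoc] using @hVU (f⁻¹ * x, f⁻¹ * y) ⟨hx', hy'⟩

variable {K : Type*} [Group K] [TopologicalSpace K] [IsTopologicalGroup K]
  {j : H →* K}

/-- A dense inducing homomorphism of a totally bounded group into a compact group extends to a
continuous homomorphism of every regular topological semigroup containing the group densely. -/
theorem exists_continuous_hom_extension [CompactSpace K] [T2Space K]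
    [IsTopologicalGroup H] (hH : IsTotallyBoundedGroup H)
    (hi : IsDenseInducing i) (hj : Continuous j) :
    ∃ φ : S →ₙ* K, Continuous φ ∧ ∀ h, φ (i h) = j h := by
  have hlim : ∀ s, ∃ k, Tendsto j (comap i (𝓝 s)) (𝓝 k) := by
    intro s
    have := hi.comap_nhds_neBot s
    obtain ⟨k, hk⟩ := exists_clusterPt_of_compactSpace (map j (comap i (𝓝 s)))
    -- The cluster point is a limit because the filter is Cauchy: write `j y = k * (k⁻¹ * j x) * j
    -- (x⁻¹ * y)` with `j x` close to `k` and `x⁻¹ * y` small.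
    refine ⟨k, fun A hA => ?_⟩
    have hc : ContinuousAt (fun p : K × K => k * p.1 * p.2) (1, 1) := by fun_prop
    have hcA := hc (show A ∈ 𝓝 (k * 1 * 1) by simpa using hA)
    rw [mem_map, nhds_prod_eq, mem_prod_self_iff] at hcA
    obtain ⟨V, hV, hVA⟩ := hcA
    obtain ⟨P, hP, hPV⟩ := exists_mem_nhds_inv_mul_mem hH hi
      (hj.continuousAt (show V ∈ 𝓝 (j 1) by simpa using hV)) s
    have hkV : (fun x => k⁻¹ * x) ⁻¹' V ∈ 𝓝 k :=
      (show ContinuousAt (fun x => k⁻¹ * x) k by fun_prop) (by simpa using hV)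
    obtain ⟨_, hxV, x, hxP, rfl⟩ := clusterPt_iff_nonempty.1 hk hkV
      (image_mem_map (preimage_mem_comap hP))
    refine ⟨P, hP, fun y hy => ?_⟩
    have := @hVA (k⁻¹ * j x, j (x⁻¹ * y)) ⟨hxV, hPV x y hxP hy⟩
    simpa using this
  have hc : Continuous (hi.extend j) := hi.continuous_extend hlim
  have he : ∀ h, hi.extend j (i h) = j h := hi.extend_eq hj
  refine ⟨⟨hi.extend j, fun s t => ?_⟩, hc, he⟩
  refine congr_fun ((hi.dense.prodMap hi.dense).equalizer
    (g := fun p : S × S => hi.extend j (p.1 * p.2))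
    (h := fun p => hi.extend j p.1 * hi.extend j p.2) (by fun_prop) (by fun_prop) ?_) (s, t)
  funext ⟨x, y⟩
  simp [← map_mul, he]

variable {φ : S →ₙ* K}

/-- If `φ s` is close to `φ p`, approximate `p` by `i x` and `s` by `i h`. Then `j (x⁻¹ * h)` is
close to `1`, so `i (x⁻¹ * h)` is close to `i 1`, and `i h = i x * i (x⁻¹ * h)` is close to `p * i 1
= p`. As such `i h` accumulate at `s`, a closed neighbourhood of `p` captures `s`. -/
theorem isInducing_of_extension (hi : IsDenseInducing i) (hj : IsInducing j)
    (hφ : Continuous φ) (hφi : ∀ h, φ (i h) = j h) : IsInducing φ := by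
  rw [isInducing_iff_nhds]
  refine fun p => le_antisymm hφ.continuousAt.le_comap fun P hP => ?_
  obtain ⟨P₀, hP₀, hP₀cl, hP₀P⟩ := exists_mem_nhds_isClosed_subset hP
  have hm : ContinuousAt (fun q : S × S => q.1 * q.2) (p, i 1) := by fun_prop
  have hmP := hm (show P₀ ∈ 𝓝 (p * i 1) by rwa [map_mul_one_of_denseRange hi.dense])
  rw [mem_map, nhds_prod_eq, mem_prod_iff] at hmP
  obtain ⟨P₁, hP₁, O, hO, hPO⟩ := hmP
  have hO1 := hi.continuous.continuousAt hO
  rw [mem_map, hj.nhds_eq_comap, mem_comap, map_one] at hO1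
  obtain ⟨B, hB, hBO⟩ := hO1
  have hd : ContinuousAt (fun q : K × K => q.1⁻¹ * q.2) (φ p, φ p) := by fun_prop
  have hdB := hd (show B ∈ 𝓝 ((φ p)⁻¹ * φ p) by simpa using hB)
  rw [mem_map, nhds_prod_eq, mem_prod_self_iff] at hdB
  obtain ⟨Q, hQ, hQB⟩ := hdB
  refine mem_comap.2 ⟨interior Q, interior_mem_nhds.2 hQ, fun s hs => hP₀P ?_⟩
  obtain ⟨_, ⟨hx₁, hxQ⟩, x, rfl⟩ := (mem_closure_iff_nhds.1 (hi.dense p))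
    (P₁ ∩ φ ⁻¹' Q) (inter_mem hP₁ (hφ.continuousAt hQ))
  rw [← hP₀cl.closure_eq, mem_closure_iff_nhds]
  intro D hD
  obtain ⟨_, ⟨hhD, hhQ⟩, h, rfl⟩ := (mem_closure_iff_nhds.1 (hi.dense s))
    (D ∩ φ ⁻¹' Q) (inter_mem hD (hφ.continuousAt (mem_interior_iff_mem_nhds.1 hs)))
  have hxh : x⁻¹ * h ∈ i ⁻¹' O := by
    refine hBO ?_
    have := @hQB (φ (i x), φ (i h)) ⟨hxQ, hhQ⟩
    simpa [hφi] using this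
  refine ⟨i h, hhD, ?_⟩
  have := @hPO (i x, i (x⁻¹ * h)) ⟨hx₁, hxh⟩
  simpa [← map_mul] using this

end CompactExtension

theorem DenseRange.surjective_of_continuous {X Y S : Type*} [TopologicalSpace X] [CompactSpace X]
    [TopologicalSpace Y] [T2Space Y] {e' : S → Y} (he' : DenseRange e') {f : X → Y}
    (hf : Continuous f) {e : S → X} (h : ∀ s, f (e s) = e' s) : Function.Surjective f := by
  rw [← range_eq_univ, ← (isCompact_range hf).isClosed.closure_eq]
  refine DenseRange.closure_range (he'.mono ?_)
  rintro _ ⟨s, rfl⟩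
  exact ⟨_, h s⟩

/-! ### Pseudocompact dense subspaces of compact groups. -/

section Pseudocompact

variable {S : Type*} [TopologicalSpace S] {K : Type*} [TopologicalSpace K] {φ : S → K}

/-- Otherwise `1 / (u ∘ φ)` is continuous, hence bounded by some `C`; then `1 ≤ C * u` on a dense
set, so everywhere, contradicting `u k = 0`. -/
theorem IsPseudocompact.exists_eq_zero (hS : IsPseudocompact S) (hφ : Continuous φ)
    (hd : DenseRange φ) {u : K → ℝ} (hu : Continuous u) (hu0 : ∀ k, 0 ≤ u k) {k : K}
    (hk : u k = 0) : ∃ s, u (φ s) = 0 := by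
  by_contra! hne
  obtain ⟨C, hC⟩ := hS (fun s => (u (φ s))⁻¹) ((hu.comp hφ).inv₀ hne)
  have hpos : ∀ s, 0 < u (φ s) := fun s => (hu0 _).lt_of_ne (hne s).symm
  have hge : ∀ x, 1 ≤ C * u x := by
    intro x
    refine hd.induction_on x (isClosed_le continuous_const (by fun_prop)) fun s => ?_
    have h1 := (le_abs_self _).trans (hC s)
    rwa [inv_le_iff_one_le_mul₀ (hpos s)] at h1
  have := hge k
  simp [hk] at this
  linarith

variable [Group K] [IsTopologicalGroup K] [CompactSpace K]

/-- Sublevel and superlevel sets of a continuous function on a pseudocompact dense subspace of a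
compact group have disjoint closures in the group. -/
theorem IsPseudocompact.disjoint_closure_image (hS : IsPseudocompact S) (hφ : IsInducing φ)
    (hd : DenseRange φ) {f : S → ℝ} (hf : Continuous f) {a b : ℝ} (hab : a < b) :
    Disjoint (closure (φ '' {s | f s < a})) (closure (φ '' {s | b < f s})) := by
  obtain ⟨W, hW, hWa⟩ := hφ.isOpen_iff.1 (isOpen_lt hf (continuous_const (y := a)))
  obtain ⟨W', hW', hWb⟩ := hφ.isOpen_iff.1 (isOpen_lt (continuous_const (y := b)) hf)
  obtain ⟨u, hu, hu0, hu1, huW⟩ := exists_continuous_smul_closure_subset hW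
  obtain ⟨u', hu', hu0', hu1', huW'⟩ := exists_continuous_smul_closure_subset hW'
  rw [Set.disjoint_left]
  intro k hk hk'
  have hkW : k ∈ closure W := closure_mono (by rw [← hWa]; exact image_preimage_subset _ _) hk
  have hkW' : k ∈ closure W' := closure_mono (by rw [← hWb]; exact image_preimage_subset _ _) hk'
  -- The translation by `φ s * k⁻¹` carries `k` to `φ s`. Adding the two nonnegative functions makes
  -- one `s` serve both closures.
  obtain ⟨s, hs⟩ := hS.exists_eq_zero hφ.continuous hd
    (u := fun x => u (x * k⁻¹) + u' (x * k⁻¹)) (by fun_prop)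
    (fun x => add_nonneg (hu0 _) (hu0' _)) (k := k) (by simp [hu1, hu1'])
  obtain ⟨h₁, h₂⟩ := (add_eq_zero_iff_of_nonneg (hu0 _) (hu0' _)).1 hs
  have hsW : φ s ∈ closure W := by simpa using huW _ h₁ k hkW
  have hsW' : φ s ∈ closure W' := by simpa using huW' _ h₂ k hkW'
  have key : ∀ {A : Set K}, IsOpen A → φ s ∈ closure A → s ∈ closure (φ ⁻¹' A) := by
    intro A hA hsA
    rw [hφ.closure_eq_preimage_closure_image, image_preimage_eq_inter_range, mem_preimage]
    exact closure_minimal (hd.open_subset_closure_inter hA) isClosed_closure hsA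
  have ha : f s ≤ a := by
    refine closure_minimal (fun t ht => ?_) (isClosed_le hf continuous_const) (key hW hsW)
    rw [hWa] at ht
    exact le_of_lt (mem_ofPred_eq ▸ ht)
  have hb : b ≤ f s := by
    refine closure_minimal (fun t ht => ?_) (isClosed_le continuous_const hf) (key hW' hsW')
    rw [hWb] at ht
    exact le_of_lt (mem_ofPred_eq ▸ ht)
  linarith

/-- A compact group is the Stone-Čech compactification of its pseudocompact dense subspaces. -/
theorem IsPseudocompact.isHomeomorph_stoneCechExtend [T2Space K] (hS : IsPseudocompact S)
    (hφ : IsInducing φ) (hd : DenseRange φ) : IsHomeomorph (stoneCechExtend hφ.continuous) := by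
  have hc := continuous_stoneCechExtend hφ.continuous
  have he : ∀ s, stoneCechExtend hφ.continuous (stoneCechUnit s) = φ s := fun s =>
    congr_fun (stoneCechExtend_extends hφ.continuous) s
  rw [isHomeomorph_iff_continuous_bijective]
  refine ⟨hc, fun p q hpq => ?_, hd.surjective_of_continuous hc he⟩
  · by_contra hne
    -- The common image of `p` and `q` would lie in the closures of both `{F < 1/3}` and `{F >
    -- 2/3}`, traced on `S`. Any two thresholds `0 < a < b < 1` would do.
    obtain ⟨F, hFp, hFq, -⟩ := exists_continuous_zero_one_of_isClosed (isClosed_singleton (x := p))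
      (isClosed_singleton (x := q)) (by simpa using hne)
    have hf : Continuous fun s : S => F (stoneCechUnit s) :=
      F.continuous.comp continuous_stoneCechUnit
    have key : ∀ {A : Set (StoneCech S)} {r}, IsOpen A → r ∈ A →
        stoneCechExtend hφ.continuous r ∈ closure (φ '' (stoneCechUnit ⁻¹' A)) := by
      intro A r hA hr
      have hr' := denseRange_stoneCechUnit.open_subset_closure_inter hA hr
      rw [← image_preimage_eq_inter_range] at hr'
      have := image_closure_subset_closure_image hc (mem_image_of_mem _ hr')
      rwa [image_image, image_congr fun s _ => he s] at this
    refine Set.disjoint_left.1 (hS.disjoint_closure_image hφ hd hf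
      (show (1 / 3 : ℝ) < 2 / 3 by norm_num))
      (key (A := {r | F r < 1 / 3}) (r := p) (isOpen_lt F.continuous continuous_const) ?_) ?_
    · have := hFp rfl
      simp_all
    · rw [hpq]
      refine key (A := {r | 2 / 3 < F r}) (isOpen_lt continuous_const F.continuous) ?_
      have := hFq rfl
      simp only [mem_ofPred_eq, this]
      norm_num

end Pseudocompact

/-! ### Comparison of the canonical compactifications with `βS`. -/

theorem WAP.lift_comp_stoneCechToWAP {S : Type u} [Semigroup S] [TopologicalSpace S]
    {K : Type v} [TopologicalSpace K] [T2Space K] [CompactSpace K] {φ : S → K}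
    (hφ : Continuous φ) {g : WAP S → K} (hg : Continuous g) (hgs : ∀ s, g (WAP.eta S s) = φ s) :
    g ∘ stoneCechToWAP S = stoneCechExtend hφ :=
  stoneCech_hom_ext (hg.comp (continuous_stoneCechExtend _)) (continuous_stoneCechExtend _) <| by
    funext s
    have h₁ := congr_fun (stoneCechExtend_extends (WAP.continuous_eta S)) s
    have h₂ := congr_fun (stoneCechExtend_extends hφ) s
    simp only [Function.comp_apply] at h₁ h₂ ⊢
    rw [h₂, stoneCechToWAP, h₁, hgs]

section CanonicalMaps

variable {S : Type u} [Semigroup S] [TopologicalSpace S] {K : Type v} [Group K]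
  [TopologicalSpace K] [IsTopologicalGroup K] [CompactSpace K] [T2Space K] {φ : S →ₙ* K}

/-- If `βS` is a compact group `K` into which `S` maps homomorphically, then all canonical
compactifications of `S` coincide with `βS`. -/
theorem isHomeomorph_canonical_maps (hφ : Continuous φ) (hd : DenseRange φ)
    (hβ : IsHomeomorph (stoneCechExtend hφ)) :
    IsHomeomorph (stoneCechToWAP S) ∧ IsHomeomorph (wapToAP S) ∧ IsHomeomorph (apToSAP S) := by
  obtain ⟨g₁, ⟨hg₁, hg₁s⟩, -⟩ := WAP.existsUnique_lift S φ hφ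
  obtain ⟨g₂, ⟨hg₂, hg₂s⟩, -⟩ := AP.existsUnique_lift S φ hφ
  obtain ⟨g₃, ⟨hg₃, hg₃s⟩, -⟩ := SAP.existsUnique_lift S φ hφ
  obtain ⟨hwa, hwas⟩ := wapToAP_spec S
  obtain ⟨has, hass⟩ := apToSAP_spec S
  have hβw : Continuous (stoneCechToWAP S) := continuous_stoneCechExtend _
  have hβws : ∀ s, stoneCechToWAP S (stoneCechUnit s) = WAP.eta S s := fun s =>
    congr_fun (stoneCechExtend_extends (WAP.continuous_eta S)) s
  have hφs : ∀ s, stoneCechExtend hφ (stoneCechUnit s) = φ s := fun s =>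
    congr_fun (stoneCechExtend_extends hφ) s
  have e₁ := WAP.lift_comp_stoneCechToWAP hφ hg₁ hg₁s
  have e₂ := WAP.lift_comp_stoneCechToWAP hφ (g := g₂ ∘ wapToAP S) (hg₂.comp hwa) fun s => by
    simp [hwas, hg₂s]
  have e₃ := WAP.lift_comp_stoneCechToWAP hφ (g := g₃ ∘ apToSAP S ∘ wapToAP S)
    (hg₃.comp (has.comp hwa)) fun s => by simp [hwas, hass, hg₃s]
  have s₁ := (WAP.denseRange_eta S).surjective_of_continuous hβw hβws
  have s₂ := (AP.denseRange_eta S).surjective_of_continuous hwa hwas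
  -- Each composite out of `βS` is the first factor of the injective map `βS → K`, hence injective;
  -- surjectivity of the earlier maps passes injectivity on to the last one.
  have i₁ : Function.Injective (stoneCechToWAP S) := .of_comp (e₁ ▸ hβ.injective)
  have i₂ : Function.Injective (wapToAP S) :=
    .of_comp_right (f := wapToAP S) (g := stoneCechToWAP S)
      (.of_comp (f := g₂) (by rw [← Function.comp_assoc, e₂]; exact hβ.injective)) s₁
  have i₃ : Function.Injective (apToSAP S) :=
    .of_comp_right (f := apToSAP S) (g := wapToAP S ∘ stoneCechToWAP S)
      (.of_comp (f := g₃) (by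
        rw [← Function.comp_assoc, ← Function.comp_assoc, Function.comp_assoc g₃, e₃]
        exact hβ.injective)) (s₂.comp s₁)
  refine ⟨isHomeomorph_iff_continuous_bijective.2 ⟨hβw, i₁, s₁⟩,
    isHomeomorph_iff_continuous_bijective.2 ⟨hwa, i₂, s₂⟩,
    isHomeomorph_iff_continuous_bijective.2 ⟨has, i₃, ?_⟩⟩
  -- The image of `S` generates `SAP S` topologically only as a group, so density is not available
  -- for surjectivity. Instead `ψ : K → SAP S` is a continuous homomorphism with `ψ ∘ g₃ = id`, and
  -- `ψ` factors through `apToSAP S`.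
  let e := hβ.homeomorph
  let ψ : K → SAP S := apToSAP S ∘ wapToAP S ∘ stoneCechToWAP S ∘ e.symm
  have hψ : Continuous ψ := has.comp (hwa.comp (hβw.comp e.symm.continuous))
  have hψs : ∀ s, ψ (φ s) = SAP.eta S s := by
    intro s
    have : e.symm (φ s) = stoneCechUnit s := e.symm_apply_eq.2 (hφs s).symm
    simp [ψ, this, hβws, hwas, hass]
  have hψm : ∀ x y, ψ (x * y) = ψ x * ψ y := fun x y =>
    congr_fun ((hd.prodMap hd).equalizer (g := fun p : K × K => ψ (p.1 * p.2))
      (h := fun p => ψ p.1 * ψ p.2) (by fun_prop) (by fun_prop)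
      (by funext ⟨s, t⟩; simp [← map_mul, hψs])) (x, y)
  let Ψ : K →ₙ* SAP S := ⟨ψ, hψm⟩
  have hid : Ψ.comp g₃ = MulHom.id (SAP S) :=
    SAP.hom_ext S (hψ.comp hg₃) continuous_id fun s => by
      change ψ (g₃ (SAP.eta S s)) = SAP.eta S s
      rw [hg₃s, hψs]
  exact fun x => ⟨wapToAP S (stoneCechToWAP S (e.symm (g₃ x))), DFunLike.congr_fun hid x⟩

/-- The group structure transported to `βS` from a compact group homeomorphic to `βS` over `S`. -/
theorem exists_group_stoneCech (hφ : Continuous φ) (hβ : IsHomeomorph (stoneCechExtend hφ)) :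
    ∃ _ : Group (StoneCech S), IsTopologicalGroup (StoneCech S) ∧
      ∀ s t : S, stoneCechUnit (s * t) = (stoneCechUnit s * stoneCechUnit t : StoneCech S) := by
  let e := hβ.homeomorph
  let _ : Group (StoneCech S) := e.toEquiv.group
  let m : StoneCech S ≃* K := e.toEquiv.mulEquiv
  have hm : IsInducing m := e.isInducing
  refine ⟨e.toEquiv.group, hm.topologicalGroup m, fun s t => m.injective ?_⟩
  have hφs : ∀ s, m (stoneCechUnit s) = φ s := fun s =>
    congr_fun (stoneCechExtend_extends hφ) s
  rw [map_mul, hφs, hφs, hφs, map_mul]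

end CanonicalMaps

theorem mainTheorem8 {S : Type u} [Semigroup S] [TopologicalSpace S] [T35Space S]
    [ContinuousMul S] (hS : IsPseudocompact S)
    {H : Type v} [Group H] [TopologicalSpace H] [IsTopologicalGroup H]
    (hH : IsTotallyBoundedGroup H)
    (i : H →ₙ* S) (hi : IsEmbedding i) (hi' : DenseRange i) :
    IsHomeomorph (stoneCechToWAP S) ∧ IsHomeomorph (wapToAP S) ∧ IsHomeomorph (apToSAP S) ∧
      ∃ _ : Group (StoneCech S), IsTopologicalGroup (StoneCech S) ∧
        ∀ s t : S, stoneCechUnit (s * t) = (stoneCechUnit s * stoneCechUnit t : StoneCech S) := by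
  obtain ⟨K, _, _, _, _, _, j, hj⟩ := hH.exists_compact_completion
  have hid : IsDenseInducing i := ⟨hi.isInducing, hi'⟩
  obtain ⟨φ, hφ, hφi⟩ := exists_continuous_hom_extension hH hid hj.continuous
  have hd : DenseRange φ := hj.dense.mono (by rintro _ ⟨h, rfl⟩; exact ⟨i h, hφi h⟩)
  have hβ := hS.isHomeomorph_stoneCechExtend (isInducing_of_extension hid hj.isInducing hφ hφi) hd
  obtain ⟨h₁, h₂, h₃⟩ := isHomeomorph_canonical_maps hφ hd hβ
  exact ⟨h₁, h₂, h₃, exists_group_stoneCech hφ hβ⟩
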